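/- Let $d\ge 1$ and let $R$ be a real symmetric $d\times d$ matrix with $R_{ij}\ge 0$ for all $i,j$ and $\sum_i R_{ij}>0$ for each $j$. Fix initial weights $a_1,\dots,a_d>0$ and an initial state $y_0\in\{1,\dots,d\}$ (for instance all $a_i=1$ and $y_0=1$). Let $(Y_n)_{n\ge 0}$ be a vertex-reinforced random walk: random variables with values in $\{1,\dots,d\}$ such that $Y_0=y_0$ almost surely and, for all $n\ge 0$ and all $j$, $$\mathbf P(Y_{n+1}=j\mid \mathcal F_n)=\frac{R_{Y_n,j}\,S_j(n)}{\sum_i R_{Y_n,i}\,S_i(n)}\quad\text{almost surely},$$ where $\mathcal F_n=\sigma(Y_0,\dots,Y_n)$, $S_i(0)=a_i$ and $S_i(n+1)=S_i(n)+\mathbf 1\{Y_{n+1}=i\}$. Let $V(n)$ be the fractional occupation vector, $V_i(n)=S_i(n)/\sum_j S_j(n)$. For $v$ in the simplex $\triangle=\{v\in\mathbb R^d: v_i\ge 0,\ \sum_i v_i=1\}$ put $N_i(v)=\sum_j R_{ij}v_j$ and $H(v)=\sum_i v_iN_i(v)$, and, when $H(v)>0$, $\pi_i(v)=v_iN_i(v)/H(v)$.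 A critical point is a $v\in\triangle$ with $H(v)>0$ and $\pi(v)=v$. Suppose that all off-diagonal entries of $R$ are positive and that all principal minors of $R$ are invertible, i.e. for every nonempty $I\subseteq\{1,\dots,d\}$ the submatrix $(R_{ij})_{i,j\in I}$ is invertible. Then the set of critical points is finite, and almost surely $V(n)$ converges as $n\to\infty$ to a critical point. -/

import Mathlib

open MeasureTheory Filter Topology

namespace VRRW

noncomputable section

/-- `N_i(v) = ∑ j, R i j * v j`. -/
def N {d : ℕ} (R : Matrix (Fin d) (Fin d) ℝ) (v : Fin d → ℝ) (i : Fin d) : ℝ :=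
  ∑ j, R i j * v j

/-- `H(v) = ∑ i, v i * N_i(v)`, the quadratic form with matrix `R`. -/
def H {d : ℕ} (R : Matrix (Fin d) (Fin d) ℝ) (v : Fin d → ℝ) : ℝ :=
  ∑ i, v i * N R v i

/-- `π_i(v) = v i * N_i(v) / H(v)`, meaningful when `H(v) > 0`. -/
def piVec {d : ℕ} (R : Matrix (Fin d) (Fin d) ℝ) (v : Fin d → ℝ) (i : Fin d) : ℝ :=
  v i * N R v i / H R v

/-- The critical points: the points `v` of the simplex (with `H(v) > 0`, so that `π(v)` is
defined) such that `π(v) = v`. -/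
def criticalSet {d : ℕ} (R : Matrix (Fin d) (Fin d) ℝ) : Set (Fin d → ℝ) :=
  {v | v ∈ stdSimplex ℝ (Fin d) ∧ 0 < H R v ∧ piVec R v = v}

/-- The weights `S(n)`: initially `a`, and each later step `n + 1` adds one to the weight of the
state `Y (n + 1)`. -/
def S {d : ℕ} {Ω : Type*} (a : Fin d → ℝ) (Y : ℕ → Ω → Fin d) : ℕ → Ω → Fin d → ℝ
  | 0, _, i => a i
  | n + 1, ω, i => S a Y n ω i + if Y (n + 1) ω = i then 1 else 0

/-- The fractional occupation vector `V(n) = S(n) / ∑ j, S_j(n)`. -/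
def V {d : ℕ} {Ω : Type*} (a : Fin d → ℝ) (Y : ℕ → Ω → Fin d) (n : ℕ) (ω : Ω) (i : Fin d) : ℝ :=
  S a Y n ω i / ∑ j, S a Y n ω j

/-- The σ-field generated by `Y 0, …, Y n`. -/
abbrev history {d : ℕ} {Ω : Type*} (Y : ℕ → Ω → Fin d) (n : ℕ) : MeasurableSpace Ω :=
  ⨆ k ≤ n, MeasurableSpace.comap (Y k) inferInstance

/-- `Y` is a vertex-reinforced random walk on `Fin d` with likelihood matrix `R`, initial
weights `a` and initial state `y₀`. Time is counted from the starting time, so with `a = 1`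
the total weight at time `n` is `d + n`. -/
structure IsVRRW {d : ℕ} {Ω : Type*} [MeasurableSpace Ω] (μ : Measure Ω)
    (R : Matrix (Fin d) (Fin d) ℝ) (a : Fin d → ℝ) (y₀ : Fin d) (Y : ℕ → Ω → Fin d) : Prop where
  measurable : ∀ n, Measurable (Y n)
  initial : ∀ᵐ ω ∂μ, Y 0 ω = y₀
  /-- `P(Y_{n+1} = j | F_n) = R_{Y_n, j} S_j(n) / ∑ i, R_{Y_n, i} S_i(n)` almost surely. -/
  transition : ∀ (n : ℕ) (j : Fin d),
    μ[(Y (n + 1) ⁻¹' {j}).indicator (fun _ => (1 : ℝ)) | history Y n] =ᵐ[μ]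
      fun ω => R (Y n ω) j * S a Y n ω j / ∑ i, R (Y n ω) i * S a Y n ω i

end

end VRRW

/-! ### Finiteness of the critical set. -/

namespace VRRW

variable {d : ℕ} {R : Matrix (Fin d) (Fin d) ℝ}

/-! Finiteness: a critical point satisfies `N R v i = H R v` on its support. Two critical points
with the same support are therefore proportional, since the corresponding principal submatrix is
invertible, and then equal because both have total mass one. There are finitely many supports.

Convergence: the 1×1 minors make the diagonal positive, so all entries of `R` lie between two
positive constants. The occupation vector satisfies `V (n+1) = V n + γ n (π (V n) - V n) + noise`
with `γ n` of order `1/n`, and two facts suffice.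

(1) The noise series converges almost surely (`IsVRRW.ae_exists_tendsto_noise`). The walk frozen at
`v` has invariant law `π(v)` by symmetry of `R`, and its Poisson equation has solutions bounded and
Lipschitz in `v` (`exists_poisson`). Hence the noise is a martingale difference, plus a telescoping
term, plus an error of order `γ n ^ 2`; the martingale is bounded in L².

(2) `H` is a strict Lyapunov function for `v' = π(v) - v`: its derivative is `2 / H` times the
variance of `N` under `v`, which vanishes only at critical points (`drift_eq`). Adding the tail of
the noise series to `V n` gives a nearby sequence with vanishing perturbation, along which `H` is
almost a Lyapunov function. Since equilibria are finite in number, the sequence converges to one of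
them (`exists_tendsto_of_lyapunov`). -/

theorem N_eq_H_of_mem_criticalSet {v : Fin d → ℝ} (hv : v ∈ criticalSet R) {i : Fin d}
    (hi : v i ≠ 0) : N R v i = H R v := by
  obtain ⟨-, hH, hpi⟩ := hv
  have h := congrFun hpi i
  rw [piVec, div_eq_iff hH.ne'] at h
  exact mul_left_cancel₀ hi h

/-- A critical point is determined by its support, so the support map into the finitely many subsets
of `Fin d` is injective on critical points. -/
theorem finite_criticalSet
    (hminors : ∀ s : Finset (Fin d), s.Nonempty →
      IsUnit (R.submatrix (fun i : s => (i : Fin d)) (fun i : s => (i : Fin d)))) :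
    (criticalSet R).Finite := by
  refine Set.Finite.of_injOn (f := fun v : Fin d → ℝ => Finset.univ.filter (fun i => v i ≠ 0))
    (t := Set.univ) (fun _ _ => Set.mem_univ _) ?_ Set.finite_univ
  intro v hv w hw hvw
  set s := Finset.univ.filter (fun i => v i ≠ 0) with hs
  have hsv : ∀ i, i ∉ s → v i = 0 := fun i hi => by simpa [hs] using hi
  have hsw : ∀ i, i ∉ s → w i = 0 := fun i hi => by
    have : s = Finset.univ.filter (fun i => w i ≠ 0) := hvw
    rw [this] at hi; simpa using hi
  have hsv' : ∀ i, i ∈ s → v i ≠ 0 := fun i hi => by simpa [hs] using hi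
  have hsw' : ∀ i, i ∈ s → w i ≠ 0 := fun i hi => by
    have : s = Finset.univ.filter (fun i => w i ≠ 0) := hvw
    rw [this] at hi; simpa using hi
  have hne : s.Nonempty := by
    by_contra hemp
    rw [Finset.not_nonempty_iff_eq_empty] at hemp
    have h1 := hv.1.2
    rw [Finset.sum_eq_zero (fun i _ => hsv i (by simp [hemp]))] at h1
    exact zero_ne_one h1
  -- On the common support `N R v = H R v` and `N R w = H R w`, so this combination is killed by the
  -- invertible submatrix indexed by `s`.
  have hker : (fun i : s => H R w * v i - H R v * w i) = 0 := by
    refine Matrix.mulVec_injective_of_isUnit (hminors s hne) ?_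
    rw [Matrix.mulVec_zero]
    funext i
    have hsum : ∑ j : s, R i j * (H R w * v j - H R v * w j)
        = ∑ j, R i j * (H R w * v j - H R v * w j) := by
      rw [Finset.sum_coe_sort s (fun j => R i j * (H R w * v j - H R v * w j))]
      refine Finset.sum_subset (Finset.subset_univ _) fun j _ hj => ?_
      simp [hsv j hj, hsw j hj]
    have h2 : ∑ j, R i j * (H R w * v j - H R v * w j)
        = H R w * N R v i - H R v * N R w i := by
      rw [N, N, Finset.mul_sum, Finset.mul_sum, ← Finset.sum_sub_distrib]
      exact Finset.sum_congr rfl fun j _ => by ring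
    have h3 : ∑ j : s, R i j * (H R w * v j - H R v * w j) = 0 := by
      rw [hsum, h2, N_eq_H_of_mem_criticalSet hv (hsv' i i.2),
        N_eq_H_of_mem_criticalSet hw (hsw' i i.2)]
      ring
    simpa [Matrix.mulVec, dotProduct] using h3
  have hall : ∀ i, H R w * v i = H R v * w i := by
    intro i
    by_cases hi : i ∈ s
    · exact sub_eq_zero.1 (congrFun hker ⟨i, hi⟩)
    · rw [hsv i hi, hsw i hi]; simp
  have hHeq : H R w = H R v := by
    have h1 : ∑ i, H R w * v i = ∑ i, H R v * w i := Finset.sum_congr rfl fun i _ => hall i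
    rwa [← Finset.mul_sum, ← Finset.mul_sum, hv.1.2, hw.1.2, mul_one, mul_one] at h1
  funext i
  have h := hall i
  rw [hHeq] at h
  exact mul_left_cancel₀ hv.2.1.ne' h

end VRRW

/-! ### Convergence of schemes with a strict Lyapunov function. -/

namespace VRRW

/-- A sequence in a compact set whose steps tend to zero and whose cluster points all lie in a
finite set converges to one of these points. -/
theorem exists_tendsto_of_mapClusterPt_finite {E : Type*} [MetricSpace E] {K Z : Set E}
    (hK : IsCompact K) (hZ : Z.Finite) {x : ℕ → E} (hx : ∀ n, x n ∈ K)
    (hstep : Tendsto (fun n => dist (x (n + 1)) (x n)) atTop (𝓝 0))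
    (hcl : ∀ p ∈ K, MapClusterPt p atTop x → p ∈ Z) :
    ∃ z ∈ K, z ∈ Z ∧ Tendsto x atTop (𝓝 z) := by
  obtain ⟨z, hzK, hz⟩ := hK.exists_mapClusterPt (f := atTop) (u := x)
    (by simpa using Eventually.of_forall (f := atTop) hx)
  refine ⟨z, hzK, hcl z hzK hz, ?_⟩
  obtain ⟨ρ, hρ, hρZ⟩ : ∃ ρ > 0, ∀ w ∈ Z, dist w z < ρ → w = z := by
    have h1 : (Z \ {z})ᶜ ∈ 𝓝 z :=
      (hZ.subset Set.sdiff_subset).isClosed.isOpen_compl.mem_nhds (by simp)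
    obtain ⟨ρ, hρ, h2⟩ := Metric.mem_nhds_iff.1 h1
    refine ⟨ρ, hρ, fun w hw hd => ?_⟩
    by_contra hne
    exact h2 hd ⟨hw, hne⟩
  rw [Metric.tendsto_atTop]
  intro r' hr'
  obtain ⟨r, hr, hrr', hrρ⟩ : ∃ r > 0, r ≤ r' ∧ 2 * r < ρ :=
    ⟨min r' (ρ / 3), by positivity, min_le_left _ _, by linarith [min_le_right r' (ρ / 3)]⟩
  -- This annulus contains no point of `Z`, so it is eventually avoided; steps shorter than `r`
  -- cannot jump across it.
  have hA : IsCompact (K ∩ {w | r ≤ dist w z ∧ dist w z ≤ 2 * r}) := by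
    refine hK.inter_right ?_
    have hd : Continuous fun w => dist w z := by fun_prop
    exact (isClosed_le continuous_const hd).inter (isClosed_le hd continuous_const)
  have hev : ∀ᶠ n in atTop, x n ∉ K ∩ {w | r ≤ dist w z ∧ dist w z ≤ 2 * r} := by
    by_contra hcon
    rw [not_eventually] at hcon
    simp only [not_not] at hcon
    obtain ⟨p, ⟨hpK, hp1, hp2⟩, hp⟩ := hA.exists_mapClusterPt_of_frequently hcon
    have := hρZ p (hcl p hpK hp) (by linarith)
    rw [this, dist_self] at hp1
    linarith
  have hev2 : ∀ᶠ n in atTop, dist (x (n + 1)) (x n) < r := hstep.eventually_lt_const hr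
  obtain ⟨n₀, hn₀⟩ := eventually_atTop.1 (hev.and hev2)
  obtain ⟨n₁, hn₁, hball⟩ :=
    (frequently_atTop.1 (hz.frequently (Metric.ball_mem_nhds z hr))) n₀
  refine ⟨n₁, fun n hn => lt_of_lt_of_le ?_ hrr'⟩
  induction n, hn using Nat.le_induction with
  | base => exact hball
  | succ m hm ih =>
    have h1 := (hn₀ m (hn₁.trans hm)).2
    have h2 := (hn₀ (m + 1) (by omega)).1
    by_contra hcon
    push Not at hcon
    exact h2 ⟨hx _, hcon, by linarith [dist_triangle (x (m + 1)) (x m) z]⟩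

/-- If `h` is nearly a Lyapunov function along a sequence in a compact set, then it converges. -/
theorem exists_tendsto_lyapunov_value {E : Type*} [MetricSpace E] {K : Set E} (hK : IsCompact K)
    {L D : E → ℝ} (hL : ContinuousOn L K) (hD : ContinuousOn D K) (hD0 : ∀ p ∈ K, 0 ≤ D p)
    (hZ : {p ∈ K | D p = 0}.Finite) {x : ℕ → E} (hx : ∀ n, x n ∈ K)
    {γ h ε : ℕ → ℝ} (hγ0 : ∀ n, 0 < γ n) (hγ : Tendsto γ atTop (𝓝 0))
    (hh : Tendsto (fun n => h n - L (x n)) atTop (𝓝 0)) (hε : Tendsto ε atTop (𝓝 0))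
    (hstep : ∀ n, h (n + 1) = h n + γ n * (D (x n) + ε n)) :
    ∃ l, Tendsto h atTop (𝓝 l) := by
  obtain ⟨BL, hBL⟩ := hK.exists_bound_of_continuousOn hL
  have hcmp : ∀ᶠ n in atTop, |h n - L (x n)| < 1 := by
    simpa using hh.abs.eventually_lt_const (by simp : |(0 : ℝ)| < 1)
  have hb : ∀ᶠ n in atTop, |h n| ≤ BL + 1 := by
    filter_upwards [hcmp] with n hn
    have h1 := hBL (x n) (hx n)
    rw [Real.norm_eq_abs] at h1
    rw [abs_lt] at hn
    rw [abs_le] at h1 ⊢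
    constructor <;> linarith [h1.1, h1.2, hn.1, hn.2]
  -- It is enough to exclude infinitely many crossings between noncritical levels, which are dense
  -- because the critical values are finite in number.
  have hdense : Dense ((L '' {p ∈ K | D p = 0})ᶜ : Set ℝ) := (hZ.image L).countable.dense_compl ℝ
  refine tendsto_of_no_upcrossings hdense ?_ ?_ ?_
  · intro a _ c hc hac ⟨hfa, hfc⟩
    obtain ⟨δ, hδ, hδZ⟩ := Metric.mem_nhds_iff.1
      ((hZ.image L).isClosed.isOpen_compl.mem_nhds hc)
    obtain ⟨r, hr, hra, hrδ⟩ : ∃ r > 0, a < c - r ∧ 2 * r < δ := by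
      refine ⟨min (c - a) δ / 3, by have := sub_pos.2 hac; positivity, ?_, ?_⟩
      · linarith [min_le_left (c - a) δ]
      · linarith [min_le_right (c - a) δ]
    have hcomp : IsCompact (K ∩ L ⁻¹' Metric.closedBall c (2 * r)) :=
      hK.of_isClosed_subset
        (hL.preimage_isClosed_of_isClosed hK.isClosed Metric.isClosed_closedBall)
        Set.inter_subset_left
    obtain ⟨η, hη, hηD⟩ := hcomp.exists_forall_le' (a := 0) (hD.mono Set.inter_subset_left) (by
      rintro p ⟨hpK, hp⟩
      refine lt_of_le_of_ne (hD0 p hpK) fun h0 => ?_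
      exact hδZ (lt_of_le_of_lt hp hrδ) ⟨p, ⟨hpK, h0.symm⟩, rfl⟩)
    obtain ⟨BD, hBD⟩ := hK.exists_bound_of_continuousOn hD
    have e1 : ∀ᶠ n in atTop, |ε n| < min η 1 := by
      simpa using hε.abs.eventually_lt_const (by simpa using hη : |(0 : ℝ)| < min η 1)
    have e2 : ∀ᶠ n in atTop, |h n - L (x n)| < r := by
      simpa using hh.abs.eventually_lt_const (by simpa using hr : |(0 : ℝ)| < r)
    have e3 : ∀ᶠ n in atTop, γ n * (BD + 1) < r := by
      have : Tendsto (fun n => γ n * (BD + 1)) atTop (𝓝 0) := by simpa using hγ.mul_const (BD + 1)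
      exact this.eventually_lt_const hr
    obtain ⟨n₀, hn₀⟩ := eventually_atTop.1 (e1.and (e2.and e3))
    obtain ⟨n₁, hn₁, hlt⟩ := (frequently_atTop.1 hfc) n₀
    -- Once above `c`, the sequence never falls below `c - r`: within `r` of level `c` the gain `η`
    -- dominates the error, and from above `c + r` one step loses less than `r`.
    have hstay : ∀ n ≥ n₁, c - r ≤ h n := by
      intro n hn
      induction n, hn using Nat.le_induction with
      | base => linarith
      | succ m hm ih =>
        obtain ⟨f1, f2, f3⟩ := hn₀ m (hn₁.trans hm)
        have f4 := hstep m
        have hγm := hγ0 m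
        rw [abs_lt] at f1 f2
        rcases le_total (h m) (c + r) with hle | hge
        · have : η ≤ D (x m) := by
            refine hηD _ ⟨hx m, ?_⟩
            simp only [Set.mem_preimage, Metric.mem_closedBall, Real.dist_eq, abs_le]
            constructor <;> linarith [f2.1, f2.2]
          have : 0 ≤ γ m * (D (x m) + ε m) :=
            mul_nonneg hγm.le (by linarith [f1.1, min_le_left η 1])
          linarith
        · have : -(BD + 1) ≤ D (x m) + ε m := by
            have h1 := hBD (x m) (hx m)
            rw [Real.norm_eq_abs, abs_le] at h1
            linarith [f1.1, min_le_right η 1, h1.1]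
          have := mul_le_mul_of_nonneg_left this hγm.le
          linarith
    obtain ⟨n₂, hn₂, hlt₂⟩ := (frequently_atTop.1 hfa) n₁
    linarith [hstay n₂ hn₂]
  · exact ⟨BL + 1, by
      simp only [eventually_map]; exact hb.mono fun n hn => (abs_le.1 hn).2⟩
  · exact ⟨-(BL + 1), by
      simp only [eventually_map]; exact hb.mono fun n hn => (abs_le.1 hn).1⟩

/-- Convergence of a stochastic approximation scheme with a strict Lyapunov function that has
finitely many equilibria. Here `x` is the scheme, `y` the scheme with the tail of the noise series
removed, `h` the Lyapunov function `L` along `y`, and `D` the derivative of `L` along the flow. -/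
theorem exists_tendsto_of_lyapunov {E : Type*} [MetricSpace E] {K : Set E} (hK : IsCompact K)
    {L D : E → ℝ} (hL : ContinuousOn L K) (hD : ContinuousOn D K) (hD0 : ∀ p ∈ K, 0 ≤ D p)
    (hZ : {p ∈ K | D p = 0}.Finite) {x y : ℕ → E} (hx : ∀ n, x n ∈ K)
    (hxy : Tendsto (fun n => dist (x n) (y n)) atTop (𝓝 0))
    {γ h ε : ℕ → ℝ} (hγ0 : ∀ n, 0 < γ n) (hγ : Tendsto γ atTop (𝓝 0))
    (hγs : Tendsto (fun n => ∑ k ∈ Finset.range n, γ k) atTop atTop)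
    {C : ℝ} (hC0 : 0 ≤ C) (hC : ∀ n, dist (y (n + 1)) (y n) ≤ C * γ n)
    (hh : Tendsto (fun n => h n - L (x n)) atTop (𝓝 0)) (hε : Tendsto ε atTop (𝓝 0))
    (hstep : ∀ n, h (n + 1) = h n + γ n * (D (x n) + ε n)) :
    ∃ z ∈ K, D z = 0 ∧ Tendsto x atTop (𝓝 z) := by
  obtain ⟨l, hl⟩ := exists_tendsto_lyapunov_value hK hL hD hD0 hZ hx hγ0 hγ hh hε hstep
  have hxstep : Tendsto (fun n => dist (x (n + 1)) (x n)) atTop (𝓝 0) := by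
    have hub : Tendsto (fun n => dist (x (n + 1)) (y (n + 1)) + C * γ n + dist (x n) (y n))
        atTop (𝓝 0) := by
      simpa using ((hxy.comp (tendsto_add_atTop_nat 1)).add (hγ.const_mul C)).add hxy
    refine squeeze_zero (fun _ => dist_nonneg) (fun n => ?_) hub
    have h1 := dist_triangle4 (x (n + 1)) (y (n + 1)) (y n) (x n)
    rw [dist_comm (y n) (x n)] at h1
    linarith [hC n]
  -- Suppose `D p > 0` at a cluster point `p`. Near `p` each step raises `h` by at least `γ η / 2`
  -- and moves `y` by at most `C γ`, so displacement is at most `2 C / η` times the gain of `h`.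
  -- Convergence of `h` makes that gain small, which traps the sequence near `p`; divergence of the
  -- sum of `γ` then forces `h` to infinity.
  obtain ⟨z, hzK, hz, hlim⟩ := exists_tendsto_of_mapClusterPt_finite hK hZ hx hxstep (by
    intro p hpK hp
    refine ⟨hpK, ?_⟩
    by_contra hne
    have hpos : 0 < D p := lt_of_le_of_ne (hD0 p hpK) (Ne.symm hne)
    set η := D p / 2 with hη
    have hη0 : 0 < η := by positivity
    obtain ⟨r, hr, hrD⟩ : ∃ r > 0, ∀ w ∈ K, dist w p < r → η < D w := by
      have := (hD p hpK).eventually_const_lt (show η < D p by linarith)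
      obtain ⟨r, hr, h2⟩ := Metric.mem_nhdsWithin_iff.1 this
      exact ⟨r, hr, fun w hw hd => h2 ⟨hd, hw⟩⟩
    have e1 : ∀ᶠ n in atTop, |ε n| < η / 2 := by
      simpa using hε.abs.eventually_lt_const (by simpa using hη0 : |(0 : ℝ)| < η / 2)
    have e2 : ∀ᶠ n in atTop, dist (x n) (y n) < r / 8 := hxy.eventually_lt_const (by positivity)
    have e3 : ∀ᶠ n in atTop, 2 * C / η * |h n - l| < r / 8 := by
      have : Tendsto (fun n => 2 * C / η * |h n - l|) atTop (𝓝 0) := by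
        simpa using (hl.sub_const l).abs.const_mul (2 * C / η)
      exact this.eventually_lt_const (by positivity)
    obtain ⟨n₀, hn₀⟩ := eventually_atTop.1 (e1.and (e2.and e3))
    obtain ⟨n₁, hn₁, hball⟩ := (frequently_atTop.1
      (hp.frequently (Metric.ball_mem_nhds p (by positivity : 0 < r / 8)))) n₀
    have hCη : 0 ≤ 2 * C / η := by positivity
    have hnear : ∀ m ≥ n₁, dist (y m) (y n₁) ≤ 2 * C / η * (h m - h n₁) → dist (x m) p < r := by
      intro m hm hd
      have h1 := hn₀ m (hn₁.trans hm)
      have h2 := hn₀ n₁ hn₁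
      have h3 : h m - h n₁ ≤ |h m - l| + |h n₁ - l| := by
        linarith [le_abs_self (h m - l), neg_abs_le (h n₁ - l)]
      have h4 := mul_le_mul_of_nonneg_left h3 hCη
      rw [mul_add] at h4
      have h5 := dist_triangle4 (x m) (y m) (y n₁) (x n₁)
      rw [dist_comm (y n₁) (x n₁)] at h5
      linarith [dist_triangle (x m) (x n₁) p, h1.2.1, h1.2.2, h2.2.1, h2.2.2]
    have hgain : ∀ m ≥ n₁, dist (x m) p < r → h m + γ m * (η / 2) ≤ h (m + 1) := by
      intro m hm hd
      have h1 := (abs_lt.1 (hn₀ m (hn₁.trans hm)).1).1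
      have h2 := hrD _ (hx m) hd
      rw [hstep m]
      have := mul_le_mul_of_nonneg_left (show η / 2 ≤ D (x m) + ε m by linarith) (hγ0 m).le
      linarith
    have hstay : ∀ m ≥ n₁, dist (y m) (y n₁) ≤ 2 * C / η * (h m - h n₁) := by
      intro m hm
      induction m, hm using Nat.le_induction with
      | base => simp
      | succ m hm ih =>
        have h1 := hgain m hm (hnear m hm ih)
        have h2 := mul_le_mul_of_nonneg_left h1 hCη
        have h3 : 2 * C / η * (h m + γ m * (η / 2)) = 2 * C / η * h m + C * γ m := by
          field_simp
        have h4 := dist_triangle (y (m + 1)) (y m) (y n₁)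
        have h5 := hC m
        rw [mul_sub] at ih ⊢
        linarith
    have hgrow : ∀ m ≥ n₁, h n₁ + (∑ k ∈ Finset.range m, γ k - ∑ k ∈ Finset.range n₁, γ k)
        * (η / 2) ≤ h m := by
      intro m hm
      induction m, hm using Nat.le_induction with
      | base => simp
      | succ m hm ih =>
        have h1 := hgain m hm (hnear m hm (hstay m hm))
        rw [Finset.sum_range_succ]
        linarith
    have htop : Tendsto (fun m => h n₁ + (∑ k ∈ Finset.range m, γ k -
        ∑ k ∈ Finset.range n₁, γ k) * (η / 2)) atTop atTop :=
      tendsto_atTop_add_const_left _ _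
        ((tendsto_atTop_add_const_right _ _ hγs).atTop_mul_const (by positivity))
    exact not_tendsto_nhds_of_tendsto_atTop
      (tendsto_atTop_mono' _ (eventually_atTop.2 ⟨n₁, hgrow⟩) htop) l hl)
  exact ⟨z, hzK, hz.2, hlim⟩

end VRRW

/-! ### Calculus of bounded Lipschitz functions. -/

namespace VRRW

/-- Bounded Lipschitz real functions on a set. -/
def BddLip {E : Type*} [PseudoMetricSpace E] (s : Set E) (f : E → ℝ) : Prop :=
  ∃ C, (∀ x ∈ s, |f x| ≤ C) ∧ ∀ x ∈ s, ∀ y ∈ s, |f x - f y| ≤ C * dist x y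

namespace BddLip

variable {E : Type*} [PseudoMetricSpace E] {s : Set E} {f g : E → ℝ}

theorem const (c : ℝ) : BddLip s (fun _ => c) :=
  ⟨|c|, fun _ _ => le_rfl, fun x _ y _ => by simp; positivity⟩

theorem exists_uniform {ι : Type*} [Fintype ι] {f : ι → E → ℝ} (hf : ∀ i, BddLip s (f i)) :
    ∃ C, 0 ≤ C ∧ ∀ i, (∀ x ∈ s, |f i x| ≤ C) ∧
      ∀ x ∈ s, ∀ y ∈ s, |f i x - f i y| ≤ C * dist x y := by
  choose C hC using hf
  have hle : ∀ i, C i ≤ ∑ j, |C j| := fun i => (le_abs_self _).trans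
    (Finset.single_le_sum (f := fun j => |C j|) (fun j _ => abs_nonneg _) (Finset.mem_univ i))
  refine ⟨∑ j, |C j|, Finset.sum_nonneg fun _ _ => abs_nonneg _, fun i => ⟨fun x hx =>
    ((hC i).1 x hx).trans (hle i), fun x hx y hy => ((hC i).2 x hx y hy).trans ?_⟩⟩
  exact mul_le_mul_of_nonneg_right (hle i) dist_nonneg

theorem add (hf : BddLip s f) (hg : BddLip s g) : BddLip s (fun x => f x + g x) := by
  obtain ⟨C, hC, hC'⟩ := hf
  obtain ⟨D, hD, hD'⟩ := hg
  refine ⟨C + D, fun x hx => (abs_add_le _ _).trans (add_le_add (hC x hx) (hD x hx)),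
    fun x hx y hy => ?_⟩
  rw [add_sub_add_comm, add_mul]
  exact (abs_add_le _ _).trans (add_le_add (hC' x hx y hy) (hD' x hx y hy))

theorem mul (hf : BddLip s f) (hg : BddLip s g) : BddLip s (fun x => f x * g x) := by
  obtain ⟨C, hC, hC'⟩ := hf
  obtain ⟨D, hD, hD'⟩ := hg
  have key : ∀ x ∈ s, ∀ y ∈ s, |f x * g x - f y * g y| ≤ (2 * C * D) * dist x y := by
    intro x hx y hy
    have h1 : f x * g x - f y * g y = f x * (g x - g y) + (f x - f y) * g y := by ring
    have h2 : |f x * (g x - g y)| ≤ C * (D * dist x y) := by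
      rw [abs_mul]
      exact mul_le_mul (hC x hx) (hD' x hx y hy) (abs_nonneg _) ((abs_nonneg _).trans (hC x hx))
    have h3 : |(f x - f y) * g y| ≤ C * dist x y * D := by
      rw [abs_mul]
      exact mul_le_mul (hC' x hx y hy) (hD y hy) (abs_nonneg _)
        ((abs_nonneg _).trans (hC' x hx y hy))
    rw [h1]
    exact (abs_add_le _ _).trans (by linarith)
  refine ⟨2 * C * D, fun x hx => ?_, key⟩
  have hC0 := (abs_nonneg _).trans (hC x hx)
  have hD0 := (abs_nonneg _).trans (hD x hx)
  rw [abs_mul]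
  have := mul_le_mul (hC x hx) (hD x hx) (abs_nonneg _) hC0
  linarith [mul_nonneg hC0 hD0]

theorem neg (hf : BddLip s f) : BddLip s (fun x => -f x) := by
  simpa using (const (s := s) (-1)).mul hf

theorem sub (hf : BddLip s f) (hg : BddLip s g) : BddLip s (fun x => f x - g x) := by
  simpa [sub_eq_add_neg] using hf.add hg.neg

theorem sum {ι : Type*} {t : Finset ι} {f : ι → E → ℝ} (hf : ∀ i, BddLip s (f i)) :
    BddLip s (fun x => ∑ i ∈ t, f i x) := by
  classical
  induction t using Finset.induction_on with
  | empty => simpa using const (s := s) 0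
  | insert i t hi ih => simpa [Finset.sum_insert hi] using (hf i).add ih

theorem inv (hf : BddLip s f) {m : ℝ} (hm : 0 < m) (hfm : ∀ x ∈ s, m ≤ f x) :
    BddLip s (fun x => (f x)⁻¹) := by
  obtain ⟨C, hC, hC'⟩ := hf
  refine ⟨max m⁻¹ (C / m ^ 2), fun x hx => ?_, fun x hx y hy => ?_⟩
  · have h0 : 0 < f x := hm.trans_le (hfm x hx)
    rw [abs_of_pos (inv_pos.2 h0)]
    exact (inv_anti₀ hm (hfm x hx)).trans (le_max_left _ _)
  · have hx0 : 0 < f x := hm.trans_le (hfm x hx)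
    have hy0 : 0 < f y := hm.trans_le (hfm y hy)
    have h1 : (f x)⁻¹ - (f y)⁻¹ = (f y - f x) / (f x * f y) := by field_simp
    rw [h1, abs_div, abs_of_pos (mul_pos hx0 hy0), abs_sub_comm]
    have h2 : m ^ 2 ≤ f x * f y := by
      rw [sq]; exact mul_le_mul (hfm x hx) (hfm y hy) hm.le hx0.le
    calc |f x - f y| / (f x * f y) ≤ |f x - f y| / m ^ 2 := by gcongr
      _ ≤ C * dist x y / m ^ 2 := by gcongr; exact hC' x hx y hy
      _ = C / m ^ 2 * dist x y := by ring
      _ ≤ _ := mul_le_mul_of_nonneg_right (le_max_right _ _) dist_nonneg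

theorem div (hf : BddLip s f) (hg : BddLip s g) {m : ℝ} (hm : 0 < m) (hgm : ∀ x ∈ s, m ≤ g x) :
    BddLip s (fun x => f x / g x) := by
  simpa [div_eq_mul_inv] using hf.mul (hg.inv hm hgm)

theorem continuousOn (hf : BddLip s f) : ContinuousOn f s := by
  obtain ⟨C, -, hC⟩ := hf
  refine (LipschitzOnWith.of_dist_le_mul (K := C.toNNReal) fun x hx y hy => ?_).continuousOn
  rw [Real.dist_eq]
  exact (hC x hx y hy).trans (mul_le_mul_of_nonneg_right (Real.le_coe_toNNReal C) dist_nonneg)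

end BddLip

/-! ### Uniformly contracting linear systems. -/

/-- A priori bound for the linear system `x - A x = b` with `A` a strict contraction for the
supremum norm. -/
theorem abs_le_of_sub_sum_eq {ι : Type*} [Fintype ι] {A : ι → ι → ℝ} {c β : ℝ} (hc : 0 < c)
    (hβ : 0 ≤ β) (hA : ∀ i, ∑ j, |A i j| ≤ 1 - c) {x b : ι → ℝ}
    (hx : ∀ i, x i - ∑ j, A i j * x j = b i) (hb : ∀ i, |b i| ≤ β) (i : ι) : |x i| ≤ β / c := by
  have hrow : ∀ i, |∑ j, A i j * x j| ≤ (1 - c) * ‖x‖ := by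
    intro i
    calc |∑ j, A i j * x j| ≤ ∑ j, |A i j * x j| := Finset.abs_sum_le_sum_abs _ _
      _ ≤ ∑ j, |A i j| * ‖x‖ := by
        refine Finset.sum_le_sum fun j _ => ?_
        rw [abs_mul]
        exact mul_le_mul_of_nonneg_left (norm_le_pi_norm x j) (abs_nonneg _)
      _ = (∑ j, |A i j|) * ‖x‖ := by rw [Finset.sum_mul]
      _ ≤ _ := mul_le_mul_of_nonneg_right (hA i) (norm_nonneg _)
  have hc1 : 0 ≤ 1 - c := (Finset.sum_nonneg fun j _ => abs_nonneg _).trans (hA i)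
  have hnorm : ‖x‖ ≤ (1 - c) * ‖x‖ + β := by
    refine (pi_norm_le_iff_of_nonneg (by positivity)).2 fun i => ?_
    have h1 : x i = ∑ j, A i j * x j + b i := by linarith [hx i]
    rw [Real.norm_eq_abs, h1]
    exact (abs_add_le _ _).trans (add_le_add (hrow i) (hb i))
  rw [le_div_iff₀ hc]
  have h2 : |x i| ≤ ‖x‖ := norm_le_pi_norm x i
  nlinarith

/-- The a priori bound with zero right-hand side gives injectivity, hence surjectivity in finite
dimension. -/
theorem exists_sub_sum_eq {ι : Type*} [Fintype ι] {A : ι → ι → ℝ} {c : ℝ} (hc : 0 < c)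
    (hA : ∀ i, ∑ j, |A i j| ≤ 1 - c) (b : ι → ℝ) :
    ∃ x : ι → ℝ, ∀ i, x i - ∑ j, A i j * x j = b i := by
  let T : (ι → ℝ) →ₗ[ℝ] (ι → ℝ) := LinearMap.id - Matrix.mulVecLin (Matrix.of A)
  have hT : ∀ x i, T x i = x i - ∑ j, A i j * x j := fun x i => by
    simp [T, Matrix.mulVec, dotProduct]
  have hinj : Function.Injective T := by
    rw [← LinearMap.ker_eq_bot, LinearMap.ker_eq_bot']
    intro x hx
    funext i
    have := abs_le_of_sub_sum_eq (x := x) (b := 0) hc le_rfl hA (fun i => by rw [← hT, hx])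
      (fun i => by simp) i
    simpa using this
  obtain ⟨x, hx⟩ := LinearMap.surjective_of_injective hinj b
  exact ⟨x, fun i => by rw [← hT, hx]⟩

/-- The solution of a uniformly contracting linear system with bounded Lipschitz coefficients is
bounded Lipschitz. -/
theorem exists_bddLip_sub_sum_eq {ι E : Type*} [Fintype ι] [PseudoMetricSpace E] {s : Set E}
    {A : E → ι → ι → ℝ} {b : E → ι → ℝ} {c : ℝ} (hc : 0 < c)
    (hA : ∀ v ∈ s, ∀ i, ∑ j, |A v i j| ≤ 1 - c) (hAL : ∀ i j, BddLip s (fun v => A v i j))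
    (hbL : ∀ i, BddLip s (fun v => b v i)) :
    ∃ g : E → ι → ℝ, (∀ v ∈ s, ∀ i, g v i - ∑ j, A v i j * g v j = b v i) ∧
      ∀ i, BddLip s (fun v => g v i) := by
  classical
  have hex : ∀ v, ∃ x : ι → ℝ, v ∈ s → ∀ i, x i - ∑ j, A v i j * x j = b v i := by
    intro v
    by_cases hv : v ∈ s
    · obtain ⟨x, hx⟩ := exists_sub_sum_eq hc (hA v hv) (b v)
      exact ⟨x, fun _ => hx⟩
    · exact ⟨0, fun h => absurd h hv⟩
  choose g hg using hex
  obtain ⟨Cb, hCb0, hCb⟩ := BddLip.exists_uniform hbL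
  obtain ⟨CA, hCA0, hCA⟩ := BddLip.exists_uniform
    (f := fun (p : ι × ι) v => A v p.1 p.2) (fun p => hAL p.1 p.2)
  have hbound : ∀ v ∈ s, ∀ i, |g v i| ≤ Cb / c := fun v hv i =>
    abs_le_of_sub_sum_eq hc hCb0 (hA v hv) (hg v hv) (fun i => (hCb i).1 v hv) i
  refine ⟨g, hg, fun i => ⟨max (Cb / c) ((Cb + Fintype.card ι * (CA * (Cb / c))) / c),
    fun v hv => (hbound v hv i).trans (le_max_left _ _), fun v hv w hw => ?_⟩⟩
  have hd : 0 ≤ dist v w := dist_nonneg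
  -- The difference of two solutions solves the system at `v` with a right-hand side of order `dist
  -- v w`, so the a priori bound applies again.
  have hsys : ∀ i, (g v i - g w i) - ∑ j, A v i j * (g v j - g w j)
      = (b v i - b w i) + ∑ j, (A v i j - A w i j) * g w j := by
    intro i
    rw [← hg v hv i, ← hg w hw i]
    simp only [mul_sub, sub_mul, Finset.sum_sub_distrib]
    ring
  have hrhs : ∀ i, |(b v i - b w i) + ∑ j, (A v i j - A w i j) * g w j|
      ≤ (Cb + Fintype.card ι * (CA * (Cb / c))) * dist v w := by
    intro i
    have h1 := (hCb i).2 v hv w hw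
    have h2 : |∑ j, (A v i j - A w i j) * g w j|
        ≤ ∑ _j : ι, CA * dist v w * (Cb / c) := by
      refine (Finset.abs_sum_le_sum_abs _ _).trans (Finset.sum_le_sum fun j _ => ?_)
      rw [abs_mul]
      exact mul_le_mul ((hCA (i, j)).2 v hv w hw) (hbound w hw j) (abs_nonneg _) (by positivity)
    rw [Finset.sum_const, Finset.card_univ, nsmul_eq_mul] at h2
    refine (abs_add_le _ _).trans ((add_le_add h1 h2).trans (le_of_eq ?_))
    ring
  have := abs_le_of_sub_sum_eq (x := fun i => g v i - g w i) hc (by positivity) (hA v hv)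
    hsys hrhs i
  refine this.trans ?_
  rw [mul_div_right_comm]
  exact mul_le_mul_of_nonneg_right (le_max_right _ _) hd

/-! ### The walk frozen at `v` and its Poisson equation. -/

variable {d : ℕ} {R : Matrix (Fin d) (Fin d) ℝ}

theorem exists_entry_bounds (hpos : ∀ i j, 0 < R i j) :
    ∃ m B, 0 < m ∧ 0 < B ∧ ∀ i j, m ≤ R i j ∧ R i j ≤ B := by
  rcases isEmpty_or_nonempty (Fin d × Fin d) with he | hne
  · exact ⟨1, 1, one_pos, one_pos, fun i j => he.elim (i, j)⟩
  · obtain ⟨p, hp⟩ := Finite.exists_min (fun p : Fin d × Fin d => R p.1 p.2)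
    obtain ⟨q, hq⟩ := Finite.exists_max (fun p : Fin d × Fin d => R p.1 p.2)
    exact ⟨_, _, hpos p.1 p.2, hpos q.1 q.2, fun i j => ⟨hp (i, j), hq (i, j)⟩⟩

theorem le_N {m : ℝ} (hm : ∀ i j, m ≤ R i j) {v : Fin d → ℝ} (hv : v ∈ stdSimplex ℝ (Fin d))
    (i : Fin d) : m ≤ N R v i := by
  calc m = ∑ j, m * v j := by rw [← Finset.mul_sum, hv.2, mul_one]
    _ ≤ _ := Finset.sum_le_sum fun j _ => mul_le_mul_of_nonneg_right (hm i j) (hv.1 j)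

theorem N_le {B : ℝ} (hB : ∀ i j, R i j ≤ B) {v : Fin d → ℝ} (hv : v ∈ stdSimplex ℝ (Fin d))
    (i : Fin d) : N R v i ≤ B := by
  calc N R v i ≤ ∑ j, B * v j :=
        Finset.sum_le_sum fun j _ => mul_le_mul_of_nonneg_right (hB i j) (hv.1 j)
    _ = B := by rw [← Finset.mul_sum, hv.2, mul_one]

theorem le_H {m : ℝ} (hm : ∀ i j, m ≤ R i j) {v : Fin d → ℝ} (hv : v ∈ stdSimplex ℝ (Fin d)) :
    m ≤ H R v := by
  calc m = ∑ j, v j * m := by rw [← Finset.sum_mul, hv.2, one_mul]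
    _ ≤ _ := Finset.sum_le_sum fun j _ => mul_le_mul_of_nonneg_left (le_N hm hv j) (hv.1 j)

theorem bddLip_coord (i : Fin d) : BddLip (stdSimplex ℝ (Fin d)) (fun v => v i) := by
  refine ⟨1, fun v hv => ?_, fun v _ w _ => ?_⟩
  · rw [abs_of_nonneg (hv.1 i), ← hv.2]
    exact Finset.single_le_sum (fun j _ => hv.1 j) (Finset.mem_univ i)
  · rw [one_mul, ← Real.dist_eq]
    exact dist_le_pi_dist v w i

theorem bddLip_N (i : Fin d) : BddLip (stdSimplex ℝ (Fin d)) (fun v => N R v i) :=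
  BddLip.sum fun j => (BddLip.const _).mul (bddLip_coord j)

theorem bddLip_H : BddLip (stdSimplex ℝ (Fin d)) (H R) :=
  BddLip.sum fun j => (bddLip_coord j).mul (bddLip_N j)

theorem bddLip_piVec (hpos : ∀ i j, 0 < R i j) (i : Fin d) :
    BddLip (stdSimplex ℝ (Fin d)) (fun v => piVec R v i) := by
  obtain ⟨m, B, hm, -, hR⟩ := exists_entry_bounds hpos
  exact ((bddLip_coord i).mul (bddLip_N i)).div bddLip_H hm
    fun v hv => le_H (fun i j => (hR i j).1) hv

/-- The transition probabilities of the walk with occupation vector frozen at `v`. -/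
noncomputable def trans {d : ℕ} (R : Matrix (Fin d) (Fin d) ℝ) (v : Fin d → ℝ) (i j : Fin d) : ℝ :=
  R i j * v j / N R v i

theorem sum_trans {v : Fin d → ℝ} {i : Fin d} (h : N R v i ≠ 0) : ∑ j, trans R v i j = 1 := by
  simp only [trans]
  rw [← Finset.sum_div]
  exact div_self h

/-- `π(v)` is invariant for the walk frozen at `v`. -/
theorem sum_piVec_mul_trans (hsymm : R.IsSymm) {v : Fin d → ℝ} (hN : ∀ i, N R v i ≠ 0)
    (j : Fin d) : ∑ i, piVec R v i * trans R v i j = piVec R v j := by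
  have h1 : ∀ i, piVec R v i * trans R v i j = R j i * v i * (v j / H R v) := by
    intro i
    have := hN i
    rw [piVec, trans, hsymm.apply j i]
    field_simp
  rw [Finset.sum_congr rfl fun i _ => h1 i, ← Finset.sum_mul, piVec, N]
  ring

theorem sum_piVec {v : Fin d → ℝ} (hH : H R v ≠ 0) : ∑ i, piVec R v i = 1 := by
  simp only [piVec]
  rw [← Finset.sum_div]
  exact div_self hH

/-- Regular solutions of the Poisson equation for the walk frozen at `v`. -/
theorem exists_poisson (hsymm : R.IsSymm) (hpos : ∀ i j, 0 < R i j) (k : Fin d) :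
    ∃ g : (Fin d → ℝ) → Fin d → ℝ,
      (∀ v ∈ stdSimplex ℝ (Fin d), ∀ i,
        g v i - ∑ j, trans R v i j * g v j = (if i = k then 1 else 0) - piVec R v k) ∧
      ∀ i, BddLip (stdSimplex ℝ (Fin d)) (fun v => g v i) := by
  obtain ⟨m, B, hm, hB, hR⟩ := exists_entry_bounds hpos
  have hc : 0 < m / B := div_pos hm hB
  have hNm : ∀ v ∈ stdSimplex ℝ (Fin d), ∀ i, m ≤ N R v i :=
    fun v hv i => le_N (fun i j => (hR i j).1) hv i
  have hNB : ∀ v ∈ stdSimplex ℝ (Fin d), ∀ i, N R v i ≤ B :=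
    fun v hv i => N_le (fun i j => (hR i j).2) hv i
  have hN0 : ∀ v ∈ stdSimplex ℝ (Fin d), ∀ i, 0 < N R v i :=
    fun v hv i => hm.trans_le (hNm v hv i)
  have hH0 : ∀ v ∈ stdSimplex ℝ (Fin d), 0 < H R v :=
    fun v hv => hm.trans_le (le_H (fun i j => (hR i j).1) hv)
  -- Doeblin minorization: `trans R v i j ≥ (m / B) v j`. Removing this rank-one part leaves a
  -- nonnegative matrix with row sums `1 - m / B`, a contraction uniformly in `v`.
  obtain ⟨g, hg, hgL⟩ := exists_bddLip_sub_sum_eq (s := stdSimplex ℝ (Fin d))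
    (A := fun v i j => trans R v i j - m / B * v j)
    (b := fun v i => (if i = k then 1 else 0) - piVec R v k) hc
    (by
      intro v hv i
      have h1 : ∀ j, |trans R v i j - m / B * v j| = trans R v i j - m / B * v j := by
        intro j
        refine abs_of_nonneg (sub_nonneg.2 ?_)
        rw [trans, le_div_iff₀ (hN0 v hv i)]
        calc m / B * v j * N R v i ≤ m / B * v j * B :=
              mul_le_mul_of_nonneg_left (hNB v hv i) (mul_nonneg hc.le (hv.1 j))
          _ = m * v j := by field_simp
          _ ≤ R i j * v j := mul_le_mul_of_nonneg_right (hR i j).1 (hv.1 j)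
      rw [Finset.sum_congr rfl fun j _ => h1 j, Finset.sum_sub_distrib,
        sum_trans (hN0 v hv i).ne', ← Finset.mul_sum, hv.2, mul_one])
    (fun i j => (((BddLip.const _).mul (bddLip_coord j)).div (bddLip_N i) hm
      fun v hv => hNm v hv i).sub ((BddLip.const _).mul (bddLip_coord j)))
    (fun i => (BddLip.const _).sub (bddLip_piVec hpos k))
  refine ⟨g, fun v hv i => ?_, hgL⟩
  have hN0' := fun i => (hN0 v hv i).ne'
  have hg' : ∀ i, g v i - ∑ j, trans R v i j * g v j + m / B * ∑ j, v j * g v j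
      = (if i = k then 1 else 0) - piVec R v k := by
    intro i
    rw [← hg v hv i, Finset.mul_sum, sub_add, ← Finset.sum_sub_distrib]
    congr 1
    exact Finset.sum_congr rfl fun j _ => by ring
  -- The removed part contributes nothing: pairing with the invariant law `π(v)` cancels `g` against
  -- its transition average, and the right-hand side has `π(v)`-mean zero.
  have hzero : m / B * ∑ j, v j * g v j = 0 := by
    have hL : ∑ i, piVec R v i * (g v i - ∑ j, trans R v i j * g v j
        + m / B * ∑ j, v j * g v j) = m / B * ∑ j, v j * g v j := by
      have h1 : ∑ i, piVec R v i * ∑ j, trans R v i j * g v j = ∑ j, piVec R v j * g v j := by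
        simp only [Finset.mul_sum]
        rw [Finset.sum_comm]
        refine Finset.sum_congr rfl fun j _ => ?_
        rw [← sum_piVec_mul_trans hsymm hN0' j, Finset.sum_mul]
        exact Finset.sum_congr rfl fun i _ => by ring
      simp only [mul_add, mul_sub, Finset.sum_add_distrib, Finset.sum_sub_distrib]
      rw [h1, sub_self, zero_add, ← Finset.sum_mul, sum_piVec (hH0 v hv).ne', one_mul]
    rw [← hL, Finset.sum_congr rfl fun i _ => by rw [hg' i]]
    simp only [mul_sub, Finset.sum_sub_distrib]
    rw [← Finset.sum_mul, sum_piVec (hH0 v hv).ne']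
    simp
  have := hg' i
  rwa [hzero, add_zero] at this

end VRRW

/-! ### Martingale series with square summable weights. -/

namespace VRRW

/-- A series of bounded martingale differences with square summable weights converges. -/
theorem ae_exists_tendsto_sum_mul_of_condExp_eq_zero {Ω : Type*} [m₀ : MeasurableSpace Ω]
    {μ : Measure Ω} [IsProbabilityMeasure μ] {ℱ : Filtration ℕ m₀} {ξ : ℕ → Ω → ℝ} {γ : ℕ → ℝ}
    {C : ℝ} (hmeas : ∀ n, StronglyMeasurable[ℱ (n + 1)] (ξ n)) (hbd : ∀ n ω, |ξ n ω| ≤ C)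
    (hcond : ∀ n, μ[ξ n | ℱ n] =ᵐ[μ] 0) (hγ : Summable fun n => γ n ^ 2) :
    ∀ᵐ ω ∂μ, ∃ c, Tendsto (fun n => ∑ k ∈ Finset.range n, γ k * ξ k ω) atTop (𝓝 c) := by
  set M : ℕ → Ω → ℝ := fun n ω => ∑ k ∈ Finset.range n, γ k * ξ k ω with hM
  have hMadp : StronglyAdapted ℱ M := fun n =>
    Finset.stronglyMeasurable_fun_sum _ fun k hk => ((hmeas k).mono
      (ℱ.mono (Finset.mem_range.1 hk))).const_mul (γ k)
  have hMsm : ∀ n, AEStronglyMeasurable (M n) μ := fun n =>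
    ((hMadp n).mono (ℱ.le n)).aestronglyMeasurable
  have hξsm : ∀ n, AEStronglyMeasurable (ξ n) μ := fun n =>
    ((hmeas n).mono (ℱ.le _)).aestronglyMeasurable
  have hMbd : ∀ n, ∃ B, ∀ ω, |M n ω| ≤ B := fun n =>
    ⟨∑ k ∈ Finset.range n, |γ k| * C, fun ω => (Finset.abs_sum_le_sum_abs _ _).trans
      (Finset.sum_le_sum fun k _ => by
        rw [abs_mul]; exact mul_le_mul_of_nonneg_left (hbd k ω) (abs_nonneg _))⟩
  choose B hB using hMbd
  have hMint : ∀ n, Integrable (M n) μ := fun n =>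
    Integrable.of_bound (hMsm n) (B n) (Eventually.of_forall (hB n))
  have hξint : ∀ n, Integrable (ξ n) μ := fun n =>
    Integrable.of_bound (hξsm n) C (Eventually.of_forall (hbd n))
  have hMξint : ∀ n, Integrable (M n * ξ n) μ := fun n =>
    (hξint n).bdd_mul (hMsm n) (Eventually.of_forall (hB n))
  have hM2int : ∀ n, Integrable (fun ω => M n ω ^ 2) μ := fun n => by
    simpa [sq] using (hMint n).bdd_mul (hMsm n) (Eventually.of_forall (hB n))
  have hξ2int : ∀ n, Integrable (fun ω => ξ n ω ^ 2) μ := fun n => by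
    simpa [sq] using (hξint n).bdd_mul (hξsm n) (Eventually.of_forall (hbd n))
  have hsucc : ∀ n, M (n + 1) - M n = γ n • ξ n := fun n => by
    funext ω
    simp [hM, Finset.sum_range_succ]
  have hmart : Martingale M ℱ μ := by
    refine martingale_of_condExp_sub_eq_zero_nat hMadp hMint fun n => ?_
    rw [hsucc]
    refine (condExp_smul (γ n) (ξ n) (ℱ n)).trans ?_
    filter_upwards [hcond n] with ω hω
    simp [hω]
  -- Orthogonality of the increments, which bounds `M` in L².
  have hcross : ∀ n, ∫ ω, M n ω * ξ n ω ∂μ = 0 := fun n => by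
    have h1 := condExp_mul_of_stronglyMeasurable_left (hMadp n) (hMξint n) (hξint n)
    have h2 : ∫ ω, (μ[M n * ξ n | ℱ n]) ω ∂μ = ∫ ω, (M n * ξ n) ω ∂μ := integral_condExp (ℱ.le n)
    have h3 : ∫ ω, (μ[M n * ξ n | ℱ n]) ω ∂μ = ∫ _, (0 : ℝ) ∂μ := by
      refine integral_congr_ae (h1.trans ?_)
      filter_upwards [hcond n] with ω hω
      simp [hω]
    simpa using h2.symm.trans h3
  have hL2 : ∀ n, ∫ ω, M n ω ^ 2 ∂μ ≤ ∑ k ∈ Finset.range n, γ k ^ 2 * C ^ 2 := by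
    intro n
    induction n with
    | zero => simp [hM]
    | succ n ih =>
      have h1 : ∀ ω, M (n + 1) ω ^ 2
          = M n ω ^ 2 + 2 * γ n * (M n ω * ξ n ω) + γ n ^ 2 * ξ n ω ^ 2 := fun ω => by
        simp only [hM, Finset.sum_range_succ]; ring
      have i1 : Integrable (fun ω => 2 * γ n * (M n ω * ξ n ω)) μ := (hMξint n).const_mul _
      have i2 : Integrable (fun ω => γ n ^ 2 * ξ n ω ^ 2) μ := (hξ2int n).const_mul _
      have h2 : ∫ ω, ξ n ω ^ 2 ∂μ ≤ C ^ 2 := by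
        have := integral_mono (hξ2int n) (integrable_const (C ^ 2)) fun ω =>
          sq_le_sq' (neg_le_of_abs_le (hbd n ω)) (le_of_abs_le (hbd n ω))
        simpa using this
      simp only [h1]
      have i3 : Integrable (fun ω => M n ω ^ 2 + 2 * γ n * (M n ω * ξ n ω)) μ := (hM2int n).add i1
      rw [integral_add i3 i2, integral_add (hM2int n) i1, integral_const_mul,
        integral_const_mul, hcross n, Finset.sum_range_succ, mul_zero, add_zero]
      exact add_le_add ih (mul_le_mul_of_nonneg_left h2 (sq_nonneg _))
  have hL2' : ∀ n, ∫ ω, M n ω ^ 2 ∂μ ≤ ∑' k, γ k ^ 2 * C ^ 2 := fun n =>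
    (hL2 n).trans ((hγ.mul_right _).sum_le_tsum _ fun k _ => by positivity)
  refine hmart.submartingale.exists_ae_tendsto_of_bdd
    (R := (1 + ∑' k, γ k ^ 2 * C ^ 2).toNNReal) fun n => ?_
  rw [eLpNorm_one_eq_lintegral_enorm, ← ofReal_integral_norm_eq_lintegral_enorm (hMint n)]
  refine ENNReal.ofReal_le_ofReal ?_
  -- The convergence theorem asks for an L¹ bound; `|x| ≤ 1 + x ^ 2` supplies it.
  calc ∫ ω, ‖M n ω‖ ∂μ ≤ ∫ ω, (1 + M n ω ^ 2) ∂μ := by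
        refine integral_mono (hMint n).norm ((integrable_const _).add (hM2int n)) fun ω => ?_
        simp only [Real.norm_eq_abs]
        nlinarith [sq_abs (M n ω), sq_nonneg (|M n ω| - 1)]
    _ = 1 + ∫ ω, M n ω ^ 2 ∂μ := by
        rw [integral_add (integrable_const _) (hM2int n)]; simp
    _ ≤ _ := by linarith [hL2' n]

end VRRW

/-! ### Weights, occupation vector and step sizes. -/

namespace VRRW

section Weights

variable {d : ℕ} {Ω : Type*} {a : Fin d → ℝ} {Y : ℕ → Ω → Fin d}

theorem S_pos (ha : ∀ i, 0 < a i) (n : ℕ) (ω : Ω) (i : Fin d) : 0 < S a Y n ω i := by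
  induction n with
  | zero => exact ha i
  | succ n ih =>
    rw [S]
    split_ifs <;> linarith

theorem sum_S (n : ℕ) (ω : Ω) : ∑ i, S a Y n ω i = ∑ i, a i + n := by
  induction n with
  | zero => simp [S]
  | succ n ih =>
    simp only [S, Finset.sum_add_distrib, ih]
    simp
    ring

theorem sum_S_pos (ha : ∀ i, 0 < a i) (n : ℕ) (ω : Ω) : 0 < ∑ i, S a Y n ω i :=
  Finset.sum_pos (fun i _ => S_pos ha n ω i) ⟨Y 0 ω, Finset.mem_univ _⟩

theorem V_mem_stdSimplex (ha : ∀ i, 0 < a i) (n : ℕ) (ω : Ω) :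
    V a Y n ω ∈ stdSimplex ℝ (Fin d) := by
  refine ⟨fun i => div_nonneg (S_pos ha n ω i).le (sum_S_pos ha n ω).le, ?_⟩
  simp only [V]
  rw [← Finset.sum_div]
  exact div_self (sum_S_pos ha n ω).ne'

theorem S_congr {n : ℕ} {ω ω' : Ω} (h : ∀ k ≤ n, Y k ω = Y k ω') : S a Y n ω = S a Y n ω' := by
  induction n with
  | zero => rfl
  | succ n ih =>
    funext i
    rw [S, S, ih fun k hk => h k (by omega), h (n + 1) le_rfl]

theorem V_congr {n : ℕ} {ω ω' : Ω} (h : ∀ k ≤ n, Y k ω = Y k ω') : V a Y n ω = V a Y n ω' := by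
  funext i
  simp only [V, S_congr h]

/-- The step sizes `1 / ∑ i, S_i(n + 1)`. -/
noncomputable def stepSize {d : ℕ} (a : Fin d → ℝ) (n : ℕ) : ℝ := 1 / (∑ i, a i + n + 1)

theorem V_succ (ha : ∀ i, 0 < a i) (n : ℕ) (ω : Ω) (i : Fin d) :
    V a Y (n + 1) ω i
      = V a Y n ω i + stepSize a n * ((if Y (n + 1) ω = i then 1 else 0) - V a Y n ω i) := by
  have h1 : 0 < ∑ i, a i + n := by rw [← sum_S (Y := Y) n ω]; exact sum_S_pos ha n ω
  have h2 : 0 < ∑ i, a i + n + 1 := by linarith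
  rw [V, V, sum_S, sum_S, stepSize, S]
  push_cast
  rw [← add_assoc]
  field_simp
  ring

theorem stepSize_pos (ha : ∀ i, 0 < a i) (n : ℕ) : 0 < stepSize a n := by
  have : 0 ≤ ∑ i, a i := Finset.sum_nonneg fun i _ => (ha i).le
  unfold stepSize
  positivity

theorem stepSize_le (ha : ∀ i, 0 < a i) (n : ℕ) : stepSize a n ≤ 1 / ((n : ℝ) + 1) := by
  have : 0 ≤ ∑ i, a i := Finset.sum_nonneg fun i _ => (ha i).le
  exact one_div_le_one_div_of_le (by positivity) (by linarith)

theorem tendsto_stepSize (ha : ∀ i, 0 < a i) : Tendsto (stepSize a) atTop (𝓝 0) :=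
  squeeze_zero (fun n => (stepSize_pos ha n).le) (stepSize_le ha)
    tendsto_one_div_add_atTop_nhds_zero_nat

theorem tendsto_sum_stepSize (ha : ∀ i, 0 < a i) :
    Tendsto (fun n => ∑ k ∈ Finset.range n, stepSize a k) atTop atTop := by
  have hT : 0 ≤ ∑ i, a i := Finset.sum_nonneg fun i _ => (ha i).le
  have h := Real.tendsto_sum_range_one_div_nat_succ_atTop.const_mul_atTop
    (show 0 < 1 / (∑ i, a i + 1) by positivity)
  refine tendsto_atTop_mono (fun n => ?_) h
  rw [Finset.mul_sum]
  refine Finset.sum_le_sum fun k _ => ?_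
  rw [one_div_mul_one_div]
  refine one_div_le_one_div_of_le (by positivity) ?_
  nlinarith [mul_nonneg hT (Nat.cast_nonneg (α := ℝ) k)]

theorem summable_stepSize_sq (ha : ∀ i, 0 < a i) : Summable fun n => stepSize a n ^ 2 := by
  have h : Summable fun n : ℕ => 1 / ((n + 1 : ℕ) : ℝ) ^ 2 :=
    (summable_nat_add_iff 1).2 (Real.summable_one_div_nat_pow.2 one_lt_two)
  refine h.of_nonneg_of_le (fun n => sq_nonneg _) fun n => ?_
  have := pow_le_pow_left₀ (stepSize_pos ha n).le (stepSize_le ha n) 2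
  simpa using this

/-- Makes the error from changing the step size in the telescoping of the noise summable. -/
theorem abs_stepSize_succ_sub_le (ha : ∀ i, 0 < a i) (n : ℕ) :
    |stepSize a (n + 1) - stepSize a n| ≤ stepSize a n ^ 2 := by
  have hT : 0 ≤ ∑ i, a i := Finset.sum_nonneg fun i _ => (ha i).le
  have h1 : stepSize a (n + 1) - stepSize a n = -(stepSize a n * stepSize a (n + 1)) := by
    simp only [stepSize]
    push_cast
    have h2 : 0 < ∑ i, a i + n + 1 := by positivity
    have h3 : 0 < ∑ i, a i + (n + 1) + 1 := by positivity
    field_simp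
    ring
  have h4 : stepSize a (n + 1) ≤ stepSize a n := by
    simp only [stepSize]
    push_cast
    exact one_div_le_one_div_of_le (by positivity) (by linarith)
  rw [h1, abs_neg, abs_of_pos (mul_pos (stepSize_pos ha _) (stepSize_pos ha _)), sq]
  exact mul_le_mul_of_nonneg_left h4 (stepSize_pos ha n).le

theorem dist_V_succ_le (ha : ∀ i, 0 < a i) (n : ℕ) (ω : Ω) :
    dist (V a Y (n + 1) ω) (V a Y n ω) ≤ stepSize a n := by
  refine (dist_pi_le_iff (stepSize_pos ha n).le).2 fun i => ?_
  rw [Real.dist_eq, V_succ ha, add_sub_cancel_left, abs_mul, abs_of_pos (stepSize_pos ha n)]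
  refine mul_le_of_le_one_right (stepSize_pos ha n).le ?_
  have hv := V_mem_stdSimplex (Y := Y) ha n ω
  have h0 := hv.1 i
  have h1 : V a Y n ω i ≤ 1 := by
    rw [← hv.2]; exact Finset.single_le_sum (fun j _ => hv.1 j) (Finset.mem_univ i)
  rw [abs_le]
  split_ifs <;> constructor <;> linarith

/-- The transition law is homogeneous of degree zero in the weights, so normalizing them changes
nothing. -/
theorem transition_eq_trans (ha : ∀ i, 0 < a i) (R : Matrix (Fin d) (Fin d) ℝ) (n : ℕ) (ω : Ω)
    (i j : Fin d) :
    R i j * S a Y n ω j / ∑ k, R i k * S a Y n ω k = trans R (V a Y n ω) i j := by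
  have h := (sum_S_pos (Y := Y) ha n ω).ne'
  have hN : N R (V a Y n ω) i = (∑ k, R i k * S a Y n ω k) / ∑ k, S a Y n ω k := by
    rw [N, Finset.sum_div]
    exact Finset.sum_congr rfl fun k _ => by rw [V]; ring
  rw [trans, hN, V, ← mul_div_assoc, div_div_div_cancel_right₀ h]

end Weights

/-! ### Measurability with respect to the history. -/

section History

variable {d : ℕ} {Ω : Type*} {Y : ℕ → Ω → Fin d}

/-- A function determined by `Y 0, …, Y n` is measurable for the history up to time `n`. -/
theorem stronglyMeasurable_history {n : ℕ} {X : Ω → ℝ}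
    (hX : ∀ ω ω', (∀ k ≤ n, Y k ω = Y k ω') → X ω = X ω') :
    StronglyMeasurable[history Y n] X := by
  let φ : Ω → Fin (n + 1) → Fin d := fun ω k => Y k ω
  have hφ : Measurable[history Y n] φ := by
    refine @measurable_pi_lambda _ _ _ (history Y n) _ _ fun k => ?_
    rw [measurable_iff_comap_le]
    exact le_iSup₂ (f := fun k (_ : k ≤ n) => MeasurableSpace.comap (Y k) inferInstance) (k : ℕ)
      (Nat.lt_succ_iff.1 k.2)
  have hfac : Function.FactorsThrough X φ := fun ω ω' h =>
    hX ω ω' fun k hk => congrFun h ⟨k, Nat.lt_succ_of_le hk⟩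
  -- The factor through `φ` lives on a finite space, so it is measurable for free; its default value
  -- `0` off the range of `φ` is never used.
  have heq : X = Function.extend φ X 0 ∘ φ := funext fun ω => (hfac.extend_apply 0 ω).symm
  rw [heq]
  exact ((measurable_of_finite (Function.extend φ X 0)).comp hφ).stronglyMeasurable

/-- The natural filtration of the walk. -/
def historyFiltration [m₀ : MeasurableSpace Ω] (hY : ∀ n, Measurable (Y n)) : Filtration ℕ m₀ where
  seq := history Y
  mono' _ _ hmn := iSup₂_le fun k hk =>
    le_iSup₂ (f := fun k (_ : k ≤ _) => MeasurableSpace.comap (Y k) inferInstance) k (hk.trans hmn)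
  le' _ := iSup₂_le fun k _ => (hY k).comap_le

end History

/-! ### Almost sure convergence of the noise series. -/

section Noise

variable {d : ℕ} {R : Matrix (Fin d) (Fin d) ℝ} {a : Fin d → ℝ} {y₀ : Fin d} {Ω : Type*}
  [MeasurableSpace Ω] {μ : Measure Ω} [IsProbabilityMeasure μ] {Y : ℕ → Ω → Fin d}

/-- One-step prediction of a bounded function of the present occupation vector and next state. -/
theorem IsVRRW.condExp_eq (hY : IsVRRW μ R a y₀ Y) (ha : ∀ i, 0 < a i)
    {g : (Fin d → ℝ) → Fin d → ℝ} {C : ℝ} (hg : ∀ v ∈ stdSimplex ℝ (Fin d), ∀ i, |g v i| ≤ C)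
    (n : ℕ) :
    μ[fun ω => g (V a Y n ω) (Y (n + 1) ω) | history Y n] =ᵐ[μ]
      fun ω => ∑ j, trans R (V a Y n ω) (Y n ω) j * g (V a Y n ω) j := by
  let G : Fin d → Ω → ℝ := fun j ω => g (V a Y n ω) j
  let I : Fin d → Ω → ℝ := fun j => (Y (n + 1) ⁻¹' {j}).indicator (fun _ => (1 : ℝ))
  have hG : ∀ j, StronglyMeasurable[history Y n] (G j) := fun j =>
    stronglyMeasurable_history fun ω ω' h => by simp only [G, V_congr h]
  have hI : ∀ j, Integrable (I j) μ := fun j =>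
    (integrable_const (1 : ℝ)).indicator (hY.measurable (n + 1) (MeasurableSet.singleton j))
  have hGI : ∀ j, Integrable (G j * I j) μ := fun j =>
    (hI j).bdd_mul ((hG j).mono ((historyFiltration hY.measurable).le n)).aestronglyMeasurable
      (Eventually.of_forall fun ω => hg _ (V_mem_stdSimplex ha n ω) j)
  have hsum : (fun ω => g (V a Y n ω) (Y (n + 1) ω)) = ∑ j, G j * I j := by
    funext ω
    rw [Finset.sum_apply, Finset.sum_eq_single (Y (n + 1) ω)]
    · simp [G, I]
    · intro j _ hj
      simp [I, hj.symm]
    · simp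
  rw [hsum]
  refine (condExp_finsetSum (fun j _ => hGI j) _).trans ?_
  have hpull : ∀ j, μ[G j * I j | history Y n] =ᵐ[μ]
      fun ω => trans R (V a Y n ω) (Y n ω) j * G j ω := by
    intro j
    refine (condExp_mul_of_stronglyMeasurable_left (hG j) (hGI j) (hI j)).trans ?_
    filter_upwards [hY.transition n j] with ω hω
    rw [Pi.mul_apply, hω, transition_eq_trans ha, mul_comm]
  filter_upwards [ae_all_iff.2 hpull] with ω hω
  rw [Finset.sum_apply]
  exact Finset.sum_congr rfl fun j _ => hω j

/-- The noise series of the occupation vector converges almost surely. -/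
theorem IsVRRW.ae_exists_tendsto_noise (hY : IsVRRW μ R a y₀ Y) (ha : ∀ i, 0 < a i)
    (hsymm : R.IsSymm) (hpos : ∀ i j, 0 < R i j) (k : Fin d) :
    ∀ᵐ ω ∂μ, ∃ c, Tendsto (fun n => ∑ l ∈ Finset.range n,
      stepSize a l * ((if Y (l + 1) ω = k then 1 else 0) - piVec R (V a Y l ω) k))
      atTop (𝓝 c) := by
  obtain ⟨g, hg, hgL⟩ := exists_poisson hsymm hpos k
  -- On the simplex `w` is the transition average of `g`, in a form whose Lipschitz dependence on
  -- `v` is immediate.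
  let w : (Fin d → ℝ) → Fin d → ℝ := fun v i =>
    g v i - ((if i = k then 1 else 0) - piVec R v k)
  have hwL : ∀ i, BddLip (stdSimplex ℝ (Fin d)) (fun v => w v i) := fun i =>
    (hgL i).sub ((BddLip.const _).sub (bddLip_piVec hpos k))
  have hw : ∀ v ∈ stdSimplex ℝ (Fin d), ∀ i, ∑ j, trans R v i j * g v j = w v i := fun v hv i => by
    simp only [w, ← hg v hv i]; ring
  obtain ⟨Cg, -, hCg⟩ := BddLip.exists_uniform hgL
  obtain ⟨Cw, hCw0, hCw⟩ := BddLip.exists_uniform hwL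
  have hV : ∀ n ω, V a Y n ω ∈ stdSimplex ℝ (Fin d) := fun n ω => V_mem_stdSimplex ha n ω
  -- By the Poisson equation the noise is `g - w` at `(V n, Y (n + 1))`. Moving the second argument
  -- of `w` back to `Y n` gives this martingale difference.
  let ξ : ℕ → Ω → ℝ := fun n ω => g (V a Y n ω) (Y (n + 1) ω) - w (V a Y n ω) (Y n ω)
  have hmeasg : ∀ n, StronglyMeasurable[history Y (n + 1)]
      (fun ω => g (V a Y n ω) (Y (n + 1) ω)) := fun n =>
    stronglyMeasurable_history fun ω ω' h => by
      rw [V_congr fun k hk => h k (by omega), h (n + 1) le_rfl]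
  have hmeasw : ∀ n, StronglyMeasurable[history Y n] (fun ω => w (V a Y n ω) (Y n ω)) := fun n =>
    stronglyMeasurable_history fun ω ω' h => by rw [V_congr h, h n le_rfl]
  let ℱ := historyFiltration hY.measurable
  have hξ := ae_exists_tendsto_sum_mul_of_condExp_eq_zero (μ := μ) (ℱ := ℱ) (ξ := ξ)
    (γ := stepSize a) (C := Cg + Cw)
    (fun n => (hmeasg n).sub ((hmeasw n).mono (ℱ.mono n.le_succ)))
    (fun n ω => (abs_sub _ _).trans
      (add_le_add ((hCg _).1 _ (hV n ω)) ((hCw _).1 _ (hV n ω))))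
    (fun n => by
      have i1 : Integrable (fun ω => g (V a Y n ω) (Y (n + 1) ω)) μ :=
        Integrable.of_bound ((hmeasg n).mono (ℱ.le (n + 1))).aestronglyMeasurable Cg
          (Eventually.of_forall fun ω => (hCg _).1 _ (hV n ω))
      have i2 : Integrable (fun ω => w (V a Y n ω) (Y n ω)) μ :=
        Integrable.of_bound ((hmeasw n).mono (ℱ.le n)).aestronglyMeasurable Cw
          (Eventually.of_forall fun ω => (hCw _).1 _ (hV n ω))
      refine (condExp_sub i1 i2 _).trans ?_
      have h1 := hY.condExp_eq ha (fun v hv i => (hCg i).1 v hv) n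
      have h2 : μ[fun ω => w (V a Y n ω) (Y n ω) | ℱ n] = fun ω => w (V a Y n ω) (Y n ω) :=
        condExp_of_stronglyMeasurable (ℱ.le n) (hmeasw n) i2
      filter_upwards [h1] with ω hω
      rw [Pi.sub_apply, h2, Pi.zero_apply, sub_eq_zero]
      exact hω.trans (hw _ (hV n ω) _))
    (summable_stepSize_sq ha)
  filter_upwards [hξ] with ω hω
  obtain ⟨c, hc⟩ := hω
  let W : ℕ → ℝ := fun n => stepSize a n * w (V a Y n ω) (Y n ω)
  -- What remains is `γ n (w (V n, Y n) - w (V n, Y (n + 1)))`, which equals `W n - W (n + 1) + r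
  -- n`; the two terms of `r` come from varying the step size and the occupation vector.
  let r : ℕ → ℝ := fun n =>
    (stepSize a (n + 1) - stepSize a n) * w (V a Y (n + 1) ω) (Y (n + 1) ω)
      + stepSize a n * (w (V a Y (n + 1) ω) (Y (n + 1) ω) - w (V a Y n ω) (Y (n + 1) ω))
  have hW : Tendsto W atTop (𝓝 0) := by
    have := bdd_le_mul_tendsto_zero' (f := fun n => w (V a Y n ω) (Y n ω)) Cw
      (Eventually.of_forall fun n => (hCw _).1 _ (hV n ω)) (tendsto_stepSize ha)
    simpa [W, mul_comm] using this
  have hr : Summable r := by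
    refine Summable.of_norm_bounded ((summable_stepSize_sq ha).mul_right (2 * Cw)) fun n => ?_
    have hγ := (stepSize_pos ha n).le
    have h1 : |(stepSize a (n + 1) - stepSize a n) * w (V a Y (n + 1) ω) (Y (n + 1) ω)|
        ≤ stepSize a n ^ 2 * Cw := by
      rw [abs_mul]
      exact mul_le_mul (abs_stepSize_succ_sub_le ha n) ((hCw _).1 _ (hV _ ω)) (abs_nonneg _)
        (sq_nonneg _)
    have h2 : |stepSize a n * (w (V a Y (n + 1) ω) (Y (n + 1) ω) - w (V a Y n ω) (Y (n + 1) ω))|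
        ≤ stepSize a n * (Cw * stepSize a n) := by
      rw [abs_mul, abs_of_nonneg hγ]
      refine mul_le_mul_of_nonneg_left (((hCw _).2 _ (hV _ ω) _ (hV _ ω)).trans ?_) hγ
      exact mul_le_mul_of_nonneg_left (dist_V_succ_le ha n ω) hCw0
    rw [Real.norm_eq_abs]
    refine (abs_add_le _ _).trans ((add_le_add h1 h2).trans (le_of_eq ?_))
    ring
  have hlim := (hc.add (hW.const_sub (W 0))).add hr.hasSum.tendsto_sum_nat
  refine ⟨_, hlim.congr fun n => ?_⟩
  rw [← Finset.sum_range_sub' W n, ← Finset.sum_add_distrib, ← Finset.sum_add_distrib]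
  refine Finset.sum_congr rfl fun l _ => ?_
  simp only [ξ, W, r, w]
  ring

end Noise

/-! ### The Lyapunov function `H`. -/

section Lyapunov

variable {d : ℕ} {R : Matrix (Fin d) (Fin d) ℝ}

theorem N_add (v u : Fin d → ℝ) (i : Fin d) : N R (v + u) i = N R v i + N R u i := by
  simp only [N, Pi.add_apply, mul_add, Finset.sum_add_distrib]

theorem N_smul (c : ℝ) (v : Fin d → ℝ) (i : Fin d) : N R (c • v) i = c * N R v i := by
  simp only [N, Pi.smul_apply, smul_eq_mul, Finset.mul_sum]
  exact Finset.sum_congr rfl fun j _ => by ring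

theorem H_add (hsymm : R.IsSymm) (v u : Fin d → ℝ) :
    H R (v + u) = H R v + 2 * ∑ i, u i * N R v i + H R u := by
  have h1 : ∑ i, v i * N R u i = ∑ i, u i * N R v i := by
    simp only [N, Finset.mul_sum]
    rw [Finset.sum_comm]
    refine Finset.sum_congr rfl fun i _ => Finset.sum_congr rfl fun j _ => ?_
    rw [hsymm.apply i j]
    ring
  simp only [H, N_add, Pi.add_apply, add_mul, mul_add, Finset.sum_add_distrib]
  rw [h1]
  ring

theorem H_smul (c : ℝ) (v : Fin d → ℝ) : H R (c • v) = c ^ 2 * H R v := by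
  simp only [H, N_smul, Pi.smul_apply, smul_eq_mul, Finset.mul_sum]
  exact Finset.sum_congr rfl fun j _ => by ring

theorem continuous_N (i : Fin d) : Continuous fun v => N R v i := by
  unfold N
  fun_prop

theorem continuous_H : Continuous (H R) := by
  unfold H N
  fun_prop

/-- The derivative of `H` along the vector field `π(v) - v`. -/
noncomputable def drift {d : ℕ} (R : Matrix (Fin d) (Fin d) ℝ) (v : Fin d → ℝ) : ℝ :=
  2 * ∑ i, (piVec R v i - v i) * N R v i

/-- Under the law `v`, `N` has mean `H`, so the sum is its variance. This form shows both the sign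
of the drift and its zeros. -/
theorem drift_eq {v : Fin d → ℝ} (hv : v ∈ stdSimplex ℝ (Fin d)) (hH : 0 < H R v) :
    drift R v = 2 / H R v * ∑ i, v i * (N R v i - H R v) ^ 2 := by
  have h1 : ∑ i, v i * (N R v i - H R v) ^ 2 = ∑ i, v i * N R v i ^ 2 - H R v ^ 2 := by
    have : ∀ i, v i * (N R v i - H R v) ^ 2
        = v i * N R v i ^ 2 - 2 * H R v * (v i * N R v i) + H R v ^ 2 * v i := fun i => by ring
    simp only [this, Finset.sum_add_distrib, Finset.sum_sub_distrib, ← Finset.mul_sum, hv.2]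
    change _ - 2 * H R v * H R v + _ = _
    ring
  have h2 : ∑ i, (piVec R v i - v i) * N R v i = (∑ i, v i * N R v i ^ 2) / H R v - H R v := by
    simp only [sub_mul, Finset.sum_sub_distrib, piVec]
    rw [Finset.sum_div]
    congr 1
    exact Finset.sum_congr rfl fun i _ => by ring
  rw [drift, h1, h2]
  field_simp

theorem drift_nonneg {v : Fin d → ℝ} (hv : v ∈ stdSimplex ℝ (Fin d)) (hH : 0 < H R v) :
    0 ≤ drift R v := by
  rw [drift_eq hv hH]
  exact mul_nonneg (by positivity)
    (Finset.sum_nonneg fun i _ => mul_nonneg (hv.1 i) (sq_nonneg _))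

theorem mem_criticalSet_of_drift_eq_zero {v : Fin d → ℝ} (hv : v ∈ stdSimplex ℝ (Fin d))
    (hH : 0 < H R v) (h : drift R v = 0) : v ∈ criticalSet R := by
  refine ⟨hv, hH, funext fun i => ?_⟩
  rw [drift_eq hv hH] at h
  have h1 := (mul_eq_zero.1 h).resolve_left (by positivity)
  rw [Finset.sum_eq_zero_iff_of_nonneg fun i _ => mul_nonneg (hv.1 i) (sq_nonneg _)] at h1
  rw [piVec, div_eq_iff hH.ne']
  rcases mul_eq_zero.1 (h1 i (Finset.mem_univ i)) with h2 | h2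
  · simp [h2]
  · rw [sub_eq_zero.1 (pow_eq_zero_iff two_ne_zero |>.1 h2)]

theorem bddLip_drift (hpos : ∀ i j, 0 < R i j) : BddLip (stdSimplex ℝ (Fin d)) (drift R) :=
  (BddLip.const 2).mul (BddLip.sum fun i =>
    ((bddLip_piVec hpos i).sub (bddLip_coord i)).mul (bddLip_N i))

/-- Deterministic convergence: a sequence in the simplex driven by `π(v) - v` with a convergent
noise series converges to a critical point. -/
theorem exists_tendsto_criticalSet (hsymm : R.IsSymm) (hpos : ∀ i j, 0 < R i j)
    (hfin : (criticalSet R).Finite) {x e : ℕ → Fin d → ℝ} (hx : ∀ n, x n ∈ stdSimplex ℝ (Fin d))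
    {γ : ℕ → ℝ} (hγ0 : ∀ n, 0 < γ n) (hγ : Tendsto γ atTop (𝓝 0))
    (hγs : Tendsto (fun n => ∑ k ∈ Finset.range n, γ k) atTop atTop)
    (hstep : ∀ n, x (n + 1) = x n + γ n • (piVec R (x n) - x n) + e n)
    {c : Fin d → ℝ} (he : Tendsto (fun n => ∑ k ∈ Finset.range n, e k) atTop (𝓝 c)) :
    ∃ p ∈ criticalSet R, Tendsto x atTop (𝓝 p) := by
  obtain ⟨m, B, hm, -, hR⟩ := exists_entry_bounds hpos
  have hH0 : ∀ v ∈ stdSimplex ℝ (Fin d), 0 < H R v :=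
    fun v hv => hm.trans_le (le_H (fun i j => (hR i j).1) hv)
  -- The tail of the noise series. Adding it to `x n` absorbs the noise, so `y` moves by exactly `γ
  -- n • F (x n)`; `y` may leave the simplex, where `H` still makes sense.
  set u : ℕ → Fin d → ℝ := fun n => c - ∑ k ∈ Finset.range n, e k with hu
  have hu0 : Tendsto u atTop (𝓝 0) := by simpa using he.const_sub c
  have hui : ∀ i, Tendsto (fun n => u n i) atTop (𝓝 0) := fun i => tendsto_pi_nhds.1 hu0 i
  have hNu : ∀ i, Tendsto (fun n => N R (u n) i) atTop (𝓝 0) := fun i => by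
    have := ((continuous_N (R := R) i).tendsto 0).comp hu0
    simpa [N, Function.comp_def] using this
  have hHu : Tendsto (fun n => H R (u n)) atTop (𝓝 0) := by
    have := ((continuous_H (R := R)).tendsto 0).comp hu0
    simpa [H, Function.comp_def] using this
  set F : (Fin d → ℝ) → Fin d → ℝ := fun v => piVec R v - v with hF
  have hFL : ∀ i, BddLip (stdSimplex ℝ (Fin d)) (fun v => F v i) := fun i =>
    (bddLip_piVec hpos i).sub (bddLip_coord i)
  obtain ⟨CF, hCF0, hCF⟩ := BddLip.exists_uniform hFL
  obtain ⟨CN, -, hCN⟩ := BddLip.exists_uniform (bddLip_N (R := R))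
  obtain ⟨CH, hCH, -⟩ : BddLip (stdSimplex ℝ (Fin d)) (fun v => H R (F v)) :=
    BddLip.sum fun i => (hFL i).mul (BddLip.sum fun j => (BddLip.const _).mul (hFL j))
  set y : ℕ → Fin d → ℝ := fun n => x n + u n with hy
  have hystep : ∀ n, y (n + 1) = y n + γ n • F (x n) := fun n => by
    simp only [hy, hu, hF, hstep n, Finset.sum_range_succ]
    abel
  obtain ⟨z, hz, hDz, hlim⟩ := exists_tendsto_of_lyapunov (K := stdSimplex ℝ (Fin d))
    (L := H R) (D := drift R) (x := x) (y := y) (γ := γ) (h := fun n => H R (y n))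
    -- Since `H` is quadratic its expansion along `y` is exact: the first term comes from evaluating
    -- the gradient at `x + u` instead of `x`, the second is the quadratic term.
    (ε := fun n => 2 * ∑ i, F (x n) i * N R (u n) i + γ n * H R (F (x n)))
    (isCompact_stdSimplex ℝ (Fin d)) continuous_H.continuousOn (bddLip_drift hpos).continuousOn
    (fun v hv => drift_nonneg hv (hH0 v hv))
    (hfin.subset fun v hv => mem_criticalSet_of_drift_eq_zero hv.1 (hH0 v hv.1) hv.2)
    hx (by simpa [hy, dist_eq_norm] using hu0.norm) hγ0 hγ hγs hCF0
    (fun n => by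
      rw [hystep, dist_self_add_left, norm_smul, Real.norm_of_nonneg (hγ0 n).le, mul_comm]
      refine mul_le_mul_of_nonneg_right ?_ (hγ0 n).le
      exact (pi_norm_le_iff_of_nonneg hCF0).2 fun i => (hCF i).1 _ (hx n))
    (by
      have h1 : Tendsto (fun n => 2 * ∑ i, N R (x n) i * u n i + H R (u n)) atTop (𝓝 0) := by
        have h2 : Tendsto (fun n => ∑ i, N R (x n) i * u n i) atTop (𝓝 0) := by
          simpa using tendsto_finsetSum (a := fun _ : Fin d => (0 : ℝ)) Finset.univ fun i _ =>
            bdd_le_mul_tendsto_zero' CN (Eventually.of_forall fun n => (hCN i).1 _ (hx n)) (hui i)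
        simpa using (h2.const_mul 2).add hHu
      refine h1.congr fun n => ?_
      simp only [hy, H_add hsymm, mul_comm (u n _)]
      ring)
    (by
      have h2 : Tendsto (fun n => ∑ i, F (x n) i * N R (u n) i) atTop (𝓝 0) := by
        simpa using tendsto_finsetSum (a := fun _ : Fin d => (0 : ℝ)) Finset.univ fun i _ =>
          bdd_le_mul_tendsto_zero' CF (Eventually.of_forall fun n => (hCF i).1 _ (hx n)) (hNu i)
      have h3 : Tendsto (fun n => γ n * H R (F (x n))) atTop (𝓝 0) := by
        simpa [mul_comm] using bdd_le_mul_tendsto_zero' (f := fun n => H R (F (x n))) CH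
          (Eventually.of_forall fun n => hCH _ (hx n)) hγ
      simpa using (h2.const_mul 2).add h3)
    (fun n => by
      have h1 : ∑ i, (γ n • F (x n)) i * N R (y n) i
          = γ n * (∑ i, F (x n) i * N R (x n) i + ∑ i, F (x n) i * N R (u n) i) := by
        rw [← Finset.sum_add_distrib, Finset.mul_sum]
        refine Finset.sum_congr rfl fun i _ => ?_
        simp only [hy, N_add, Pi.smul_apply, smul_eq_mul]
        ring
      have h2 : drift R (x n) = 2 * ∑ i, F (x n) i * N R (x n) i := rfl
      simp only [hystep n, H_add hsymm, H_smul]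
      rw [h1, h2]
      ring)
  exact ⟨z, mem_criticalSet_of_drift_eq_zero hz (hH0 z hz) hDz, hlim⟩

end Lyapunov

/-! ### Positivity of all entries and the conclusion. -/

/-- Invertible 1×1 minors exclude zeros on the diagonal. Full positivity is what gives the uniform
Doeblin bound and keeps `H` away from zero on the simplex. -/
theorem pos_of_isUnit_submatrix {d : ℕ} {R : Matrix (Fin d) (Fin d) ℝ}
    (hnonneg : ∀ i j, 0 ≤ R i j) (hoff : ∀ i j, i ≠ j → 0 < R i j)
    (hminors : ∀ s : Finset (Fin d), s.Nonempty →
      IsUnit (R.submatrix (fun i : s => (i : Fin d)) (fun i : s => (i : Fin d))))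
    (i j : Fin d) : 0 < R i j := by
  rcases eq_or_ne i j with rfl | hij
  · refine lt_of_le_of_ne (hnonneg i i) fun h0 => ?_
    have hu := hminors {i} (Finset.singleton_nonempty i)
    have hz : R.submatrix (fun k : ({i} : Finset (Fin d)) => (k : Fin d))
        (fun k : ({i} : Finset (Fin d)) => (k : Fin d)) = 0 := by
      ext k l
      have hk := Finset.mem_singleton.1 k.2
      have hl := Finset.mem_singleton.1 l.2
      simp [hk, hl, ← h0]
    rw [hz] at hu
    exact not_isUnit_zero hu
  · exact hoff i j hij

end VRRW

theorem mainTheorem5 {d : ℕ} (R : Matrix (Fin d) (Fin d) ℝ)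
    (hsymm : R.IsSymm) (hnonneg : ∀ i j, 0 ≤ R i j) (hcol : ∀ j, 0 < ∑ i, R i j)
    (hoff : ∀ i j, i ≠ j → 0 < R i j)
    (hminors : ∀ s : Finset (Fin d), s.Nonempty →
      IsUnit (R.submatrix (fun i : s => (i : Fin d)) (fun i : s => (i : Fin d))))
    (a : Fin d → ℝ) (ha : ∀ i, 0 < a i) (y₀ : Fin d)
    {Ω : Type*} [MeasurableSpace Ω] (μ : Measure Ω) [IsProbabilityMeasure μ]
    (Y : ℕ → Ω → Fin d) (hY : VRRW.IsVRRW μ R a y₀ Y) :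
    (VRRW.criticalSet R).Finite ∧
      ∀ᵐ ω ∂μ, ∃ p ∈ VRRW.criticalSet R,
        Tendsto (fun n => VRRW.V a Y n ω) atTop (𝓝 p) := by
  have hpos := VRRW.pos_of_isUnit_submatrix hnonneg hoff hminors
  have hfin := VRRW.finite_criticalSet hminors
  refine ⟨hfin, ?_⟩
  filter_upwards [ae_all_iff.2 (hY.ae_exists_tendsto_noise ha hsymm hpos)] with ω hω
  choose c hc using hω
  refine VRRW.exists_tendsto_criticalSet hsymm hpos hfin
    (e := fun n k => VRRW.stepSize a n *
      ((if Y (n + 1) ω = k then 1 else 0) - VRRW.piVec R (VRRW.V a Y n ω) k))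
    (fun n => VRRW.V_mem_stdSimplex ha n ω) (VRRW.stepSize_pos ha) (VRRW.tendsto_stepSize ha)
    (VRRW.tendsto_sum_stepSize ha) (fun n => ?_) (c := c) (tendsto_pi_nhds.2 fun k => ?_)
  · funext k
    simp only [Pi.add_apply, Pi.smul_apply, Pi.sub_apply, smul_eq_mul, VRRW.V_succ ha]
    ring
  · simpa only [Finset.sum_apply] using hc k
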